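/- For metric spaces $E,F$ and a non-decreasing function $\phi:[0,\infty)\to[0,\infty)$, a map $T:E\to F$ is called a $\phi$-isometry if $T$ is a bijection, $d_F(Tx,Ty)\le\phi(d_E(x,y))$ for all $x,y\in E$, and $d_E(T^{-1}f,T^{-1}g)\le\phi(d_F(f,g))$ for all $f,g\in F$. For a locally compact Hausdorff space $X$, let $C_0(X)$ be the space of continuous real-valued functions on $X$ vanishing at infinity, with the supremum norm. **Theorem.** There is a function $\Delta:[0,\infty)^2\to[0,\infty)$ with $\Delta(M,0)=0$ for all $M$ such that the following holds. Let $X$ and $Y$ be locally compact Hausdorff spaces, let $1\le M<\sqrt{16/15}$ and $L\ge 0$, and let $T:C_0(X)\to C_0(Y)$ be a $\phi$-isometry for $\phi(t)=Mt+L$ with $T(0)=0$. Then there exist a homeomorphism $\varphi:X\to Y$ and a continuous map $\lambda:X\to\{-1,1\}$ such that the formula $$If(y)=\lambda(\varphi^{-1}(y))\,f(\varphi^{-1}(y))\qquad(f\in C_0(X),\ y\in Y)$$ defines a surjective linear isometry $I:C_0(X)\to C_0(Y)$, and $$\|Tf-If\|\le 76(M-1)\|f\|+\Delta(M,L)\qquad\text{for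 every } f\in C_0(X).$$ -/

import Mathlib

open scoped NNReal ZeroAtInfty

universe u v

/-- `T : E → F` is a `φ`-isometry between metric spaces: `φ` is a non-decreasing self-map of
`[0, ∞)`, `T` is a bijection, and both `T` and its inverse have `φ` as a modulus. -/
structure IsPhiIsometry {E F : Type*} [MetricSpace E] [MetricSpace F]
    (φ : ℝ≥0 → ℝ≥0) (T : E → F) : Prop where
  monotone : Monotone φ
  bijective : Function.Bijective T
  nndist_map_le : ∀ x y : E, nndist (T x) (T y) ≤ φ (nndist x y)
  nndist_symm_le : ∀ f g : F,
    nndist ((Equiv.ofBijective T bijective).symm f) ((Equiv.ofBijective T bijective).symm g)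
      ≤ φ (nndist f g)

open Filter Topology

namespace ZeroAtInftyContinuousMap

/-! ### Sup norm and bump functions -/

section Basic

variable {X : Type*} [TopologicalSpace X]

/-! Fix `x` and a bump `h` of height `2r` peaking at `x`. The coarse bound on the inverse keeps `T
h` and `T (-h)` about `4r` apart at some `y`, so their values there are near `±2r`, up to a common
sign. If `‖f‖ ≤ r` and `f` is nearly constant on the support of `h`, then `f` lies within about `2r
∓ f x` of `±h`. The forward bound then traps `T f y` from both sides around `± M * f x`
(`exists_approx`).

Shrinking the support and using compactness removes the oscillation term (`exists_tracks`). The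
point and sign do not depend on `r` (`exists_forall_tracks`). Applying this to the inverse as well
yields mutually inverse continuous maps (`exists_homeomorph`). Taking `r` comparable to `‖f‖ + L`
gives the estimate, with `9` in place of `76`. -/

theorem abs_apply_le_norm (f : C₀(X, ℝ)) (x : X) : |f x| ≤ ‖f‖ :=
  f.toBCF.norm_coe_le_norm x

theorem norm_le_of_forall_abs_le {f : C₀(X, ℝ)} {c : ℝ} (hc : 0 ≤ c) (h : ∀ x, |f x| ≤ c) :
    ‖f‖ ≤ c :=
  (BoundedContinuousFunction.norm_le (f := f.toBCF) hc).2 h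

theorem abs_sub_apply_le_dist (f g : C₀(X, ℝ)) (x : X) : |f x - g x| ≤ dist f g := by
  rw [dist_eq_norm]
  exact abs_apply_le_norm (f - g) x

theorem exists_abs_apply_eq_norm {f : C₀(X, ℝ)} (hf : f ≠ 0) : ∃ x, |f x| = ‖f‖ := by
  obtain ⟨x₀, hx₀⟩ : ∃ x, f x ≠ 0 := by
    by_contra! h
    exact hf (ext h)
  have hlim : Tendsto (fun x ↦ |f x|) (cocompact X) (𝓝 0) := by
    simpa using (zero_at_infty f).abs
  obtain ⟨x, hx⟩ := (map_continuous f).abs.exists_forall_ge' x₀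
    ((hlim.eventually (gt_mem_nhds (abs_pos.2 hx₀))).mono fun _ h ↦ h.le)
  exact ⟨x, le_antisymm (abs_apply_le_norm f x) (norm_le_of_forall_abs_le (abs_nonneg _) hx)⟩

theorem exists_bump [T2Space X] [LocallyCompactSpace X] {x : X} {U : Set X} (hU : U ∈ 𝓝 x)
    {c : ℝ} (hc : 0 ≤ c) :
    ∃ h : C₀(X, ℝ), h x = c ∧ (∀ z, 0 ≤ h z) ∧ (∀ z, h z ≤ c) ∧ ∀ z ∉ U, h z = 0 := by
  obtain ⟨f, hf1, hf0, hfc, hf⟩ := exists_continuous_one_zero_of_isCompact (isCompact_singleton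
    (x := x)) (isOpen_interior (s := U)).isClosed_compl
    (by simpa [mem_interior_iff_mem_nhds] using hU)
  refine ⟨c • ⟨f, hfc.is_zero_at_infty⟩, ?_, fun z ↦ ?_, fun z ↦ ?_, fun z hz ↦ ?_⟩
  · have hfx : f x = 1 := hf1 rfl
    exact (congrArg (c * ·) hfx).trans (mul_one c)
  · exact mul_nonneg hc (hf z).1
  · exact mul_le_of_le_one_right hc (hf z).2
  · have hfz : f z = 0 := hf0 (fun h ↦ hz (interior_subset h))
    exact (congrArg (c * ·) hfz).trans (mul_zero c)

theorem exists_bump_norm_le [T2Space X] [LocallyCompactSpace X] {x : X} {U : Set X}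
    (hU : U ∈ 𝓝 x) {c : ℝ} (hc : 0 ≤ c) :
    ∃ h : C₀(X, ℝ), h x = c ∧ (∀ z, 0 ≤ h z) ∧ ‖h‖ ≤ c ∧ ∀ z ∉ U, h z = 0 := by
  obtain ⟨h, hx, h0, h1, hz⟩ := exists_bump hU hc
  exact ⟨h, hx, h0, norm_le_of_forall_abs_le hc fun z ↦ by rw [abs_of_nonneg (h0 z)]; exact h1 z,
    hz⟩

end Basic

/-- A bijection between spaces of functions vanishing at infinity which fixes `0` and which is,
together with its inverse, Lipschitz for large distances with constant `M` close to `1`. -/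
structure IsCoarseIsometry {X Y : Type*} [TopologicalSpace X] [TopologicalSpace Y] (M L : ℝ)
    (T : C₀(X, ℝ) ≃ C₀(Y, ℝ)) : Prop where
  one_le : 1 ≤ M
  lt : M < 1.033
  nonneg : 0 ≤ L
  map_zero : T 0 = 0
  dist_map_le : ∀ f g, dist (T f) (T g) ≤ M * dist f g + L
  dist_symm_le : ∀ f g, dist (T.symm f) (T.symm g) ≤ M * dist f g + L

/-- On the ball of radius `r`, the value of `T f` at `y` is approximately `s * (M * f x)`. -/
def Tracks {X Y : Type*} [TopologicalSpace X] [TopologicalSpace Y] (M L : ℝ)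
    (T : C₀(X, ℝ) → C₀(Y, ℝ)) (r : ℝ) (x : X) (y : Y) (s : ℝ) : Prop :=
  ∀ f, ‖f‖ ≤ r → |T f y - s * (M * f x)| ≤ 8 * (M - 1) * r + 3 * L

/-! ### Points and signs tracked by a coarse isometry -/

namespace IsCoarseIsometry

variable {X Y : Type*} [TopologicalSpace X] [TopologicalSpace Y] {M L : ℝ}
  {T : C₀(X, ℝ) ≃ C₀(Y, ℝ)}

theorem symm (hT : IsCoarseIsometry M L T) : IsCoarseIsometry M L T.symm where
  one_le := hT.one_le
  lt := hT.lt
  nonneg := hT.nonneg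
  map_zero := by rw [Equiv.symm_apply_eq, hT.map_zero]
  dist_map_le := hT.dist_symm_le
  dist_symm_le := hT.dist_map_le

theorem norm_map_le (hT : IsCoarseIsometry M L T) (f : C₀(X, ℝ)) : ‖T f‖ ≤ M * ‖f‖ + L := by
  simpa [hT.map_zero] using hT.dist_map_le f 0

theorem norm_symm_le (hT : IsCoarseIsometry M L T) (g : C₀(Y, ℝ)) :
    ‖T.symm g‖ ≤ M * ‖g‖ + L :=
  hT.symm.norm_map_le g

theorem exists_approx [T2Space X] [LocallyCompactSpace X] (hT : IsCoarseIsometry M L T) {r : ℝ}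
    (hr : 0 < r) (hrL : 100 * L ≤ r) {x : X} {U : Set X} (hU : U ∈ 𝓝 x) :
    ∃ (y : Y) (s : ℝ), (s = 1 ∨ s = -1) ∧ ∀ f, ‖f‖ ≤ r → ∀ ε ≥ 0, (∀ z ∈ U, |f z - f x| ≤ ε) →
      |T f y - s * (M * f x)| ≤ 8 * (M - 1) * r + 3 * L + M * ε := by
  obtain ⟨hM1, hM2, hL, -, hd, -⟩ := id hT
  -- Height `2r` ensures that off `U`, where `h` vanishes, `|f z| ≤ r ≤ 2r ∓ f x`.
  obtain ⟨h, hx, h0, h1, hz⟩ := exists_bump hU (c := 2 * r) (by positivity)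
  have hnorm : ‖h‖ ≤ 2 * r := norm_le_of_forall_abs_le (by positivity)
    fun z ↦ by rw [abs_of_nonneg (h0 z)]; exact h1 z
  set w := T h - T (-h) with hw
  have hw1 : 4 * r ≤ M * ‖w‖ + L := by
    have h2 := hT.dist_symm_le (T h) (T (-h))
    have h3 := abs_sub_apply_le_dist h (-h) x
    rw [T.symm_apply_apply, T.symm_apply_apply, dist_eq_norm (T h)] at h2
    have h4 := le_abs_self (h x - (-h) x)
    rw [neg_apply, hx] at h4
    rw [neg_apply, hx] at h3
    linarith
  have hw0 : w ≠ 0 := by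
    intro h0
    rw [h0, norm_zero] at hw1
    linarith
  obtain ⟨y, hy⟩ := exists_abs_apply_eq_norm hw0
  -- `M * (2 - M) ≤ 1`, so the factor `2 - M` replaces division by `M`.
  have hw2 : 4 * (2 - M) * r - L ≤ ‖w‖ := by
    have : (2 - M) * (4 * r) ≤ (2 - M) * (M * ‖w‖ + L) :=
      mul_le_mul_of_nonneg_left hw1 (by linarith)
    nlinarith [mul_nonneg (sq_nonneg (M - 1)) (norm_nonneg w), mul_nonneg (sub_nonneg.2 hM1) hL]
  have hp := (abs_apply_le_norm (T h) y).trans (hT.norm_map_le h)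
  have hn := (abs_apply_le_norm (T (-h)) y).trans (hT.norm_map_le (-h))
  rw [norm_neg] at hn
  have hMn : M * ‖h‖ ≤ M * (2 * r) := mul_le_mul_of_nonneg_left hnorm (by linarith)
  have hwy : w y = T h y - T (-h) y := rfl
  have key : ∀ f : C₀(X, ℝ), ‖f‖ ≤ r → ∀ ε ≥ 0, (∀ z ∈ U, |f z - f x| ≤ ε) →
      |T f y - T h y| ≤ M * (2 * r - f x + ε) + L ∧
      |T f y - T (-h) y| ≤ M * (2 * r + f x + ε) + L := by
    intro f hf ε hε hosc
    have hfx := abs_le.1 ((abs_apply_le_norm f x).trans hf)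
    refine ⟨(abs_sub_apply_le_dist _ _ y).trans ((hd _ _).trans ?_),
      (abs_sub_apply_le_dist _ _ y).trans ((hd _ _).trans ?_)⟩
    · gcongr
      rw [dist_eq_norm]
      refine norm_le_of_forall_abs_le (by linarith) fun z ↦ ?_
      have hfz := abs_le.1 ((abs_apply_le_norm f z).trans hf)
      rw [sub_apply, abs_le]
      by_cases hzU : z ∈ U
      · have := abs_le.1 (hosc z hzU)
        have := h0 z
        have := h1 z
        constructor <;> linarith
      · rw [hz z hzU]
        constructor <;> linarith
    · gcongr
      rw [dist_eq_norm]
      refine norm_le_of_forall_abs_le (by linarith) fun z ↦ ?_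
      have hfz := abs_le.1 ((abs_apply_le_norm f z).trans hf)
      rw [sub_apply, neg_apply, abs_le]
      by_cases hzU : z ∈ U
      · have := abs_le.1 (hosc z hzU)
        have := h0 z
        have := h1 z
        constructor <;> linarith
      · rw [hz z hzU]
        constructor <;> linarith
  rw [abs_le] at hp hn
  rcases le_total 0 (w y) with hs | hs
  · refine ⟨y, 1, Or.inl rfl, fun f hf ε hε hosc ↦ ?_⟩
    obtain ⟨h3, h4⟩ := key f hf ε hε hosc
    rw [abs_of_nonneg hs] at hy
    rw [abs_le] at h3 h4 ⊢
    constructor <;> linarith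
  · refine ⟨y, -1, Or.inr rfl, fun f hf ε hε hosc ↦ ?_⟩
    obtain ⟨h3, h4⟩ := key f hf ε hε hosc
    rw [abs_of_nonpos hs] at hy
    rw [abs_le] at h3 h4 ⊢
    constructor <;> linarith

theorem exists_tracks [T2Space X] [LocallyCompactSpace X] (hT : IsCoarseIsometry M L T) {r : ℝ}
    (hr : 0 < r) (hrL : 100 * L ≤ r) (x : X) :
    ∃ (y : Y) (s : ℝ), (s = 1 ∨ s = -1) ∧ Tracks M L T r x y s := by
  obtain ⟨hM1, hM2, hL, -, -, -⟩ := id hT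
  have hex : ∀ U : Set X, ∃ (y : Y) (s : ℝ), (s = 1 ∨ s = -1) ∧ (U ∈ 𝓝 x → ∀ f, ‖f‖ ≤ r →
      ∀ ε ≥ 0, (∀ z ∈ U, |f z - f x| ≤ ε) →
      |T f y - s * (M * f x)| ≤ 8 * (M - 1) * r + 3 * L + M * ε) := by
    intro U
    by_cases hU : U ∈ 𝓝 x
    · obtain ⟨y, s, hs, h⟩ := hT.exists_approx hr hrL hU
      exact ⟨y, s, hs, fun _ ↦ h⟩
    · obtain ⟨y, s, hs, -⟩ := hT.exists_approx hr hrL (x := x) univ_mem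
      exact ⟨y, s, hs, fun h ↦ absurd h hU⟩
  choose y s hs hys using hex
  -- An ultrafilter of neighbourhoods shrinking to `x` gives one limit point and sign valid for all
  -- `f` at once.
  have hne : ((𝓝 x).smallSets ⊓ 𝓟 {U | U ∈ 𝓝 x}).NeBot :=
    frequently_mem_iff_neBot.1 (frequently_smallSets_mem (𝓝 x))
  let 𝒰 : Ultrafilter (Set X) := Ultrafilter.of ((𝓝 x).smallSets ⊓ 𝓟 {U | U ∈ 𝓝 x})
  have h𝒰 : (𝒰 : Filter (Set X)) ≤ (𝓝 x).smallSets ⊓ 𝓟 {U | U ∈ 𝓝 x} := Ultrafilter.of_le _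
  have hev : ∀ f : C₀(X, ℝ), ‖f‖ ≤ r → ∀ ε > 0,
      ∀ᶠ U in 𝒰, |T f (y U) - s U * (M * f x)| ≤ 8 * (M - 1) * r + 3 * L + M * ε := by
    intro f hf ε hε
    have h1 : {z | |f z - f x| ≤ ε} ∈ 𝓝 x := by
      filter_upwards [(map_continuous f).continuousAt.eventually (Metric.ball_mem_nhds (f x) hε)]
        with z hz
      exact (Metric.mem_ball.1 hz).le
    filter_upwards [h𝒰 (mem_inf_of_right (mem_principal_self _)),
      h𝒰 (mem_inf_of_left (eventually_smallSets.2 ⟨_, h1, fun _ h ↦ h⟩))] with U hU hU'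
    exact hys U hU f hf ε hε.le hU'
  obtain ⟨σ, hσ, hσs⟩ : ∃ σ : ℝ, (σ = 1 ∨ σ = -1) ∧ ∀ᶠ U in 𝒰, s U = σ := by
    rcases Ultrafilter.eventually_or.1 (Eventually.of_forall hs : ∀ᶠ U in 𝒰, _) with h | h
    exacts [⟨1, Or.inl rfl, h⟩, ⟨-1, Or.inr rfl, h⟩]
  -- Since `f₀ x = r`, `|T f₀ (y U)|` stays above `0.1 * r`; as `T f₀` vanishes at infinity, the
  -- points `y U` cannot escape.
  obtain ⟨f₀, hf₀x, -, hf₀, -⟩ := exists_bump_norm_le (x := x) univ_mem hr.le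
  have hgap : 0.1 * r ≤ M * r - (8 * (M - 1) * r + 3 * L + M * (0.1 * r)) := by nlinarith
  obtain ⟨K, hK, hKf⟩ := mem_cocompact.1 ((zero_at_infty (T f₀)).eventually
    (Metric.ball_mem_nhds (0 : ℝ) (by positivity : 0 < 0.1 * r)))
  have hyK : ∀ᶠ U in 𝒰, y U ∈ K := by
    filter_upwards [hev f₀ hf₀ (0.1 * r) (by positivity)] with U hU
    by_contra hc
    have h1 : |T f₀ (y U)| < 0.1 * r := by simpa using hKf hc
    rw [hf₀x] at hU
    rw [abs_le] at hU
    rw [abs_lt] at h1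
    rcases hs U with h | h <;> rw [h] at hU <;> linarith
  obtain ⟨y₀, -, hy₀⟩ := hK.ultrafilter_le_nhds (𝒰.map y) (le_principal_iff.2 hyK)
  have hy₀ : Tendsto y 𝒰 (𝓝 y₀) := hy₀
  refine ⟨y₀, σ, hσ, fun f hf ↦ le_of_forall_pos_le_add fun δ hδ ↦ ?_⟩
  have hlim : Tendsto (fun U ↦ |T f (y U) - σ * (M * f x)|) 𝒰 (𝓝 |T f y₀ - σ * (M * f x)|) :=
    ((((map_continuous (T f)).tendsto y₀).comp hy₀).sub_const _).abs
  refine le_of_tendsto hlim ?_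
  filter_upwards [hev f hf (δ / M) (by positivity), hσs] with U hU hsU
  rwa [hsU, mul_div_cancel₀ _ (by positivity)] at hU

/-- A bump `g` at `y` vanishing at `y'` would force `M * T.symm g x` to be both large and small. The
ratio `1.5` keeps the error at the larger radius below the size forced at the smaller one. -/
theorem Tracks.eq_of_le [T2Space Y] [LocallyCompactSpace Y] (hT : IsCoarseIsometry M L T)
    {r r' : ℝ} (hr : 0 < r) (hrL : 100 * L ≤ r) (hrr : r ≤ r') (hr' : r' ≤ 1.5 * r) {x : X}
    {y y' : Y} {s s' : ℝ} (hs : s = 1 ∨ s = -1) (hs' : s' = 1 ∨ s' = -1)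
    (h : Tracks M L T r x y s) (h' : Tracks M L T r' x y' s') : y = y' ∧ s = s' := by
  obtain ⟨hM1, hM2, hL, -, -, -⟩ := id hT
  -- The largest height for which the coarse bound gives `‖T.symm g‖ ≤ r`.
  have hρ : 0 ≤ (r - L) / M := div_nonneg (by linarith) (by linarith)
  have hMρ : M * ((r - L) / M) = r - L := mul_div_cancel₀ _ (by positivity)
  have hρr : 0.95 * r ≤ (r - L) / M := by
    rw [le_div_iff₀ (by positivity)]
    nlinarith
  have hE : 8 * (M - 1) * r ≤ 0.264 * r := mul_le_mul_of_nonneg_right (by linarith) hr.le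
  have hE' : 8 * (M - 1) * r' ≤ 0.264 * (1.5 * r) := 
    mul_le_mul (by linarith) hr' (by linarith) (by norm_num)
  have main : ∀ U ∈ 𝓝 y, ∃ g : C₀(Y, ℝ), g y = (r - L) / M ∧ (∀ z, 0 ≤ g z) ∧
      (∀ z ∉ U, g z = 0) ∧ ‖T.symm g‖ ≤ r := by
    intro U hU
    obtain ⟨g, hgy, hg0, hg, hgz⟩ := exists_bump_norm_le hU hρ
    refine ⟨g, hgy, hg0, hgz, (hT.norm_symm_le g).trans ?_⟩
    nlinarith
  have hyy : y = y' := by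
    by_contra hne
    obtain ⟨g, hgy, hg0, hgz, hg⟩ := main {y'}ᶜ (isOpen_compl_singleton.mem_nhds hne)
    have h1 := h _ hg
    have h2 := h' _ (hg.trans hrr)
    rw [T.apply_symm_apply, abs_le] at h1 h2
    rw [hgy] at h1
    rw [hgz y' (by simp)] at h2
    rcases hs with rfl | rfl <;> rcases hs' with rfl | rfl <;> linarith
  subst hyy
  refine ⟨rfl, ?_⟩
  obtain ⟨g, hgy, -, -, hg⟩ := main Set.univ univ_mem
  have h1 := h _ hg
  have h2 := h' _ (hg.trans hrr)
  rw [T.apply_symm_apply, hgy, abs_le] at h1 h2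
  rcases hs with rfl | rfl <;> rcases hs' with rfl | rfl <;> first | rfl | (exfalso; linarith)

theorem exists_forall_tracks [T2Space X] [LocallyCompactSpace X] [T2Space Y]
    [LocallyCompactSpace Y] (hT : IsCoarseIsometry M L T) (x : X) :
    ∃ (y : Y) (s : ℝ), (s = 1 ∨ s = -1) ∧
      ∀ r, 0 < r → 100 * L ≤ r → Tracks M L T r x y s := by
  have hex : ∀ r : ℝ, ∃ (y : Y) (s : ℝ), 0 < r → 100 * L ≤ r →
      (s = 1 ∨ s = -1) ∧ Tracks M L T r x y s := by
    intro r
    -- A default value for inadmissible radii; `Y` is not assumed nonempty.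
    obtain ⟨y₀, -⟩ := hT.exists_tracks (r := 100 * L + 1) (by linarith [hT.nonneg])
      (by linarith) x
    by_cases h : 0 < r ∧ 100 * L ≤ r
    · obtain ⟨y, s, h⟩ := hT.exists_tracks h.1 h.2 x
      exact ⟨y, s, fun _ _ ↦ h⟩
    · exact ⟨y₀, 0, fun h1 h2 ↦ absurd ⟨h1, h2⟩ h⟩
  choose y s hys using hex
  have hchain : ∀ n : ℕ, ∀ r r' : ℝ, 0 < r → 100 * L ≤ r → r ≤ r' → r' ≤ 1.5 ^ n * r →
      y r = y r' ∧ s r = s r' := by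
    intro n
    induction n with
    | zero =>
      intro r r' _ _ h1 h2
      rw [pow_zero, one_mul] at h2
      rw [le_antisymm h1 h2]
      exact ⟨rfl, rfl⟩
    | succ n ih =>
      intro r r' hr hrL h1 h2
      have h3 : r ≤ 1.5 * r := by linarith
      rcases le_total r' (1.5 * r) with h | h
      · exact Tracks.eq_of_le hT hr hrL h1 h (hys r hr hrL).1
          (hys r' (by linarith) (by linarith)).1 (hys r hr hrL).2
          (hys r' (by linarith) (by linarith)).2
      · have h4 := Tracks.eq_of_le hT hr hrL h3 le_rfl (hys r hr hrL).1
          (hys _ (by linarith) (by linarith)).1 (hys r hr hrL).2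
          (hys _ (by linarith) (by linarith)).2
        have h5 := ih (1.5 * r) r' (by linarith) (by linarith) h (by rw [pow_succ] at h2; linarith)
        exact ⟨h4.1.trans h5.1, h4.2.trans h5.2⟩
  have hle : ∀ r r' : ℝ, 0 < r → 100 * L ≤ r → r ≤ r' → y r = y r' ∧ s r = s r' := by
    intro r r' hr hrL h
    obtain ⟨n, hn⟩ := pow_unbounded_of_one_lt (r' / r) (by norm_num : (1 : ℝ) < 1.5)
    exact hchain n r r' hr hrL h ((div_le_iff₀ hr).1 hn.le)
  have hL := hT.nonneg
  refine ⟨y (100 * L + 1), s (100 * L + 1), (hys _ (by linarith) (by linarith)).1,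
    fun r hr hrL ↦ ?_⟩
  have h : y (100 * L + 1) = y r ∧ s (100 * L + 1) = s r := by
    rcases le_total r (100 * L + 1) with h | h
    · exact (hle _ _ hr hrL h).imp Eq.symm Eq.symm
    · exact hle _ _ (by linarith) (by linarith) h
  rw [h.1, h.2]
  exact (hys r hr hrL).2

/-- A bump `f` at `x` vanishing at `x'` makes `T f y` large, while tracking by the inverse makes it
small. -/
theorem eq_of_forall_tracks [T2Space X] [LocallyCompactSpace X] (hT : IsCoarseIsometry M L T)
    {x x' : X} {y : Y} {s t : ℝ} (hs : s = 1 ∨ s = -1) (ht : t = 1 ∨ t = -1)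
    (h : ∀ r, 0 < r → 100 * L ≤ r → Tracks M L T r x y s)
    (h' : ∀ r, 0 < r → 100 * L ≤ r → Tracks M L T.symm r y x' t) : x' = x := by
  obtain ⟨hM1, hM2, hL, -, -, -⟩ := id hT
  by_contra hne
  obtain ⟨ρ, hρ⟩ : ∃ ρ, ρ = 100 * L + 1 := ⟨_, rfl⟩
  have hρ0 : 0 < ρ := by linarith
  obtain ⟨f, hfx, hf0, hf, hfz⟩ := exists_bump_norm_le
    (isOpen_compl_singleton.mem_nhds (Ne.symm hne) : {x'}ᶜ ∈ 𝓝 x) hρ0.le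
  have h1 := h ρ hρ0 (by linarith) f hf
  have hMρ : M * ρ ≤ 1.033 * ρ := by gcongr
  have hg : ‖T f‖ ≤ 1.043 * ρ := by
    have := mul_le_mul_of_nonneg_left hf (by linarith : 0 ≤ M)
    linarith [hT.norm_map_le f]
  have h2 := h' (1.043 * ρ) (by positivity) (by linarith) (T f) hg
  rw [T.symm_apply_apply, hfz x' (by simp)] at h2
  rw [hfx] at h1
  have hE : 8 * (M - 1) * ρ ≤ 0.264 * ρ := mul_le_mul_of_nonneg_right (by linarith) hρ0.le
  have h3 : |T f y| ≤ M * |T f y| := le_mul_of_one_le_left (abs_nonneg _) hM1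
  have h4 : |0 - t * (M * T f y)| = M * |T f y| := by
    rw [zero_sub, abs_neg, abs_mul, abs_mul, abs_of_nonneg (by linarith : 0 ≤ M)]
    rcases ht with rfl | rfl <;> simp
  have h5 := neg_abs_le (T f y)
  have h6 := le_abs_self (T f y)
  rw [h4] at h2
  rw [abs_le] at h1
  rcases hs with rfl | rfl <;> linarith

/-- For a bump `g` supported in `V`, `g (ϕ x)` is close to `σ x * M * T.symm g x`. Near `x₀` this
keeps `g (ϕ x)` nonzero, and `g ≥ 0` fixes the sign. -/
theorem eventually_mem_and_eq [T2Space Y] [LocallyCompactSpace Y] (hT : IsCoarseIsometry M L T)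
    {ϕ : X → Y} {σ : X → ℝ} (hσ : ∀ x, σ x = 1 ∨ σ x = -1)
    (h : ∀ x r, 0 < r → 100 * L ≤ r → Tracks M L T r x (ϕ x) (σ x)) (x₀ : X) {V : Set Y}
    (hV : V ∈ 𝓝 (ϕ x₀)) : ∀ᶠ x in 𝓝 x₀, ϕ x ∈ V ∧ σ x = σ x₀ := by
  obtain ⟨hM1, hM2, hL, -, -, -⟩ := id hT
  obtain ⟨ρ, hρ⟩ : ∃ ρ, ρ = 100 * L + 1 := ⟨_, rfl⟩
  have hρ0 : 0 < ρ := by linarith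
  obtain ⟨g, hgy, hg0, hg, hgz⟩ := exists_bump_norm_le hV hρ0.le
  have hMρ : M * ρ ≤ 1.033 * ρ := by gcongr
  have hf : ‖T.symm g‖ ≤ 1.043 * ρ := by
    have := mul_le_mul_of_nonneg_left hg (by linarith : 0 ≤ M)
    linarith [hT.norm_symm_le g]
  have hE : 8 * (M - 1) * (1.043 * ρ) ≤ 0.264 * (1.043 * ρ) :=
    mul_le_mul_of_nonneg_right (by linarith) (by linarith)
  have key : ∀ x, |g (ϕ x) - σ x * (M * T.symm g x)| ≤ 0.306 * ρ := by
    intro x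
    have := h x (1.043 * ρ) (by positivity) (by linarith) _ hf
    rw [T.apply_symm_apply] at this
    linarith
  filter_upwards [(map_continuous (T.symm g)).continuousAt.eventually
    (Metric.ball_mem_nhds (T.symm g x₀) (by positivity : 0 < 0.01 * ρ))] with x hx
  have hx : |T.symm g x - T.symm g x₀| < 0.01 * ρ := hx
  have hMx : |M * T.symm g x - M * T.symm g x₀| ≤ 1.033 * (0.01 * ρ) := by
    rw [← mul_sub, abs_mul, abs_of_nonneg (by linarith : 0 ≤ M)]
    gcongr
  have h0 := key x₀
  have h1 := key x
  rw [hgy] at h0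
  rw [abs_le] at h0 h1 hMx
  have hgx := hg0 (ϕ x)
  have hs : σ x = σ x₀ := by
    rcases hσ x with h | h <;> rcases hσ x₀ with h' | h' <;> rw [h] at h1 <;> rw [h'] at h0 <;>
      first | (exfalso; linarith) | rw [h, h']
  refine ⟨?_, hs⟩
  by_contra hc
  rw [hgz _ hc, hs] at h1
  rcases hσ x₀ with h | h <;> rw [h] at h0 h1 <;> linarith

theorem exists_homeomorph [T2Space X] [LocallyCompactSpace X] [T2Space Y]
    [LocallyCompactSpace Y] (hT : IsCoarseIsometry M L T) :
    ∃ (ϕ : X ≃ₜ Y) (σ : X → ℝ), Continuous σ ∧ (∀ x, σ x = 1 ∨ σ x = -1) ∧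
      ∀ x r, 0 < r → 100 * L ≤ r → Tracks M L T r x (ϕ x) (σ x) := by
  choose ϕ σ hσ hϕ using hT.exists_forall_tracks
  choose ψ τ hτ hψ using hT.symm.exists_forall_tracks
  refine ⟨⟨⟨ϕ, ψ, fun x ↦ eq_of_forall_tracks hT (hσ x) (hτ _) (hϕ x) (hψ _),
    fun y ↦ eq_of_forall_tracks hT.symm (hτ y) (hσ _) (hψ y) (hϕ _)⟩,
    continuous_iff_continuousAt.2 fun x V hV ↦
      (hT.eventually_mem_and_eq hσ hϕ x hV).mono fun _ h ↦ h.1,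
    continuous_iff_continuousAt.2 fun y V hV ↦
      (hT.symm.eventually_mem_and_eq hτ hψ y hV).mono fun _ h ↦ h.1⟩, σ,
    continuous_iff_continuousAt.2 fun x ↦ ?_, hσ, hϕ⟩
  exact (continuousAt_const (y := σ x)).congr
    ((hT.eventually_mem_and_eq hσ hϕ x univ_mem).mono fun _ h ↦ h.2.symm)

theorem abs_sub_le_of_tracks (hT : IsCoarseIsometry M L T) {x : X} {y : Y} {s : ℝ}
    (hs : s = 1 ∨ s = -1) (h : ∀ r, 0 < r → 100 * L ≤ r → Tracks M L T r x y s)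
    (f : C₀(X, ℝ)) : |T f y - s * f x| ≤ 9 * (M - 1) * ‖f‖ + 30 * L := by
  obtain ⟨hM1, hM2, hL, h0, -, -⟩ := id hT
  rcases (add_nonneg (norm_nonneg f) (mul_nonneg (by norm_num : (0 : ℝ) ≤ 100) hL)).eq_or_lt
    with hr | hr
  · have hf : f = 0 := norm_le_zero_iff.1 (by linarith)
    subst hf
    rw [h0]
    simpa using hL
  -- With radius `‖f‖ + 100 * L`, the `L` terms total at most `(800 * 0.033 + 3) * L ≤ 30 * L`.
  · have h1 := h _ hr (by linarith [norm_nonneg f]) f (by linarith)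
    have h2 := mul_le_mul_of_nonneg_left (abs_apply_le_norm f x) (sub_nonneg.2 hM1)
    have h3 : (M - 1) * L ≤ 0.033 * L := mul_le_mul_of_nonneg_right (by linarith) hL
    have h4 : |s * (M * f x) - s * f x| = (M - 1) * |f x| := by
      rw [← mul_sub, ← sub_one_mul, abs_mul, abs_mul, abs_of_nonneg (sub_nonneg.2 hM1)]
      rcases hs with rfl | rfl <;> simp
    have h5 := abs_sub_le (T f y) (s * (M * f x)) (s * f x)
    linarith

end IsCoarseIsometry

/-! ### Signed composition isometries -/

section WeightedComp

variable {X Y : Type*} [TopologicalSpace X] [TopologicalSpace Y]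

/-- The weighted composition `y ↦ σ y * f (ψ y)` with a continuous sign `σ`. -/
def weightedComp (ψ : Y ≃ₜ X) (σ : Y → ℝ) (hσ : Continuous σ) (hσ' : ∀ y, |σ y| = 1)
    (f : C₀(X, ℝ)) : C₀(Y, ℝ) where
  toFun y := σ y * f (ψ y)
  continuous_toFun := hσ.mul ((map_continuous f).comp ψ.continuous)
  zero_at_infty' := by
    rw [tendsto_zero_iff_abs_tendsto_zero]
    have h := ((zero_at_infty f).comp ψ.isClosedEmbedding.tendsto_cocompact).abs
    rw [abs_zero] at h
    refine h.congr fun y ↦ ?_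
    simp [abs_mul, hσ']

theorem weightedComp_apply (ψ : Y ≃ₜ X) (σ : Y → ℝ) (hσ : Continuous σ) (hσ' : ∀ y, |σ y| = 1)
    (f : C₀(X, ℝ)) (y : Y) : weightedComp ψ σ hσ hσ' f y = σ y * f (ψ y) :=
  rfl

theorem norm_weightedComp_le (ψ : Y ≃ₜ X) (σ : Y → ℝ) (hσ : Continuous σ)
    (hσ' : ∀ y, |σ y| = 1) (f : C₀(X, ℝ)) : ‖weightedComp ψ σ hσ hσ' f‖ ≤ ‖f‖ :=
  norm_le_of_forall_abs_le (norm_nonneg f) fun y ↦ by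
    rw [weightedComp_apply, abs_mul, hσ', one_mul]
    exact abs_apply_le_norm f _

theorem weightedComp_weightedComp (ϕ : X ≃ₜ Y) (σ : X → ℝ) (hσ : Continuous σ)
    (hσ' : ∀ x, |σ x| = 1) (f : C₀(X, ℝ)) :
    weightedComp ϕ σ hσ hσ' (weightedComp ϕ.symm (σ ∘ ϕ.symm) (hσ.comp ϕ.symm.continuous)
      (fun y ↦ hσ' (ϕ.symm y)) f) = f := by
  ext x
  have h : σ x * σ x = 1 := by rw [← abs_mul_abs_self, hσ', one_mul]
  simp only [weightedComp_apply, Function.comp_apply, ϕ.symm_apply_apply]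
  rw [← mul_assoc, h, one_mul]

theorem weightedComp_symm_weightedComp (ϕ : X ≃ₜ Y) (σ : X → ℝ) (hσ : Continuous σ)
    (hσ' : ∀ x, |σ x| = 1) (g : C₀(Y, ℝ)) :
    weightedComp ϕ.symm (σ ∘ ϕ.symm) (hσ.comp ϕ.symm.continuous) (fun y ↦ hσ' (ϕ.symm y))
      (weightedComp ϕ σ hσ hσ' g) = g := by
  ext y
  have h : σ (ϕ.symm y) * σ (ϕ.symm y) = 1 := by rw [← abs_mul_abs_self, hσ', one_mul]
  simp only [weightedComp_apply, Function.comp_apply, ϕ.apply_symm_apply]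
  rw [← mul_assoc, h, one_mul]

/-- Weighted composition with a homeomorphism and a continuous sign, as a linear isometry. -/
def weightedCompIsometry (ϕ : X ≃ₜ Y) (σ : X → ℝ) (hσ : Continuous σ) (hσ' : ∀ x, |σ x| = 1) :
    C₀(X, ℝ) ≃ₗᵢ[ℝ] C₀(Y, ℝ) where
  toFun := weightedComp ϕ.symm (σ ∘ ϕ.symm) (hσ.comp ϕ.symm.continuous) fun y ↦ hσ' (ϕ.symm y)
  invFun := weightedComp ϕ σ hσ hσ'
  map_add' f g := by ext y; simp only [weightedComp_apply, add_apply]; ring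
  map_smul' c f := by
    ext y; simp only [weightedComp_apply, smul_apply, smul_eq_mul, RingHom.id_apply]; ring
  left_inv := weightedComp_weightedComp ϕ σ hσ hσ'
  right_inv := weightedComp_symm_weightedComp ϕ σ hσ hσ'
  norm_map' f := by
    refine le_antisymm (norm_weightedComp_le ϕ.symm (σ ∘ ϕ.symm)
      (hσ.comp ϕ.symm.continuous) (fun y ↦ hσ' (ϕ.symm y)) f) ?_
    have h := norm_weightedComp_le ϕ σ hσ hσ' (weightedComp ϕ.symm (σ ∘ ϕ.symm)
      (hσ.comp ϕ.symm.continuous) (fun y ↦ hσ' (ϕ.symm y)) f)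
    rwa [weightedComp_weightedComp] at h

end WeightedComp

end ZeroAtInftyContinuousMap

/-! ### Conclusion for affine moduli -/

open ZeroAtInftyContinuousMap

theorem IsPhiIsometry.isCoarseIsometry {X Y : Type*} [TopologicalSpace X] [TopologicalSpace Y]
    {M L : ℝ≥0} {T : C₀(X, ℝ) → C₀(Y, ℝ)} (hM : 1 ≤ M) (hM' : (M : ℝ) < Real.sqrt (16 / 15))
    (hT : IsPhiIsometry (fun t : ℝ≥0 ↦ M * t + L) T) (h0 : T 0 = 0) :
    IsCoarseIsometry M L (Equiv.ofBijective T hT.bijective) where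
  one_le := hM
  lt := hM'.trans_le (Real.sqrt_le_iff.2 ⟨by norm_num, by norm_num⟩)
  nonneg := L.coe_nonneg
  map_zero := h0
  dist_map_le f g := by
    have h := hT.nndist_map_le f g
    rw [← NNReal.coe_le_coe] at h
    exact h
  dist_symm_le f g := by
    have h := hT.nndist_symm_le f g
    rw [← NNReal.coe_le_coe] at h
    exact h

theorem theorem3p5 :
    ∃ Δ : ℝ≥0 → ℝ≥0 → ℝ≥0, (∀ M : ℝ≥0, Δ M 0 = 0) ∧
      ∀ (X : Type u) (Y : Type v)
        [TopologicalSpace X] [T2Space X] [LocallyCompactSpace X]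
        [TopologicalSpace Y] [T2Space Y] [LocallyCompactSpace Y]
        (M L : ℝ≥0) (T : C₀(X, ℝ) → C₀(Y, ℝ)),
        1 ≤ M → (M : ℝ) < Real.sqrt (16 / 15) →
        IsPhiIsometry (fun t : ℝ≥0 => M * t + L) T → T 0 = 0 →
        ∃ (ϕ : X ≃ₜ Y) (sgn : X → ℝ) (I : C₀(X, ℝ) ≃ₗᵢ[ℝ] C₀(Y, ℝ)),
          Continuous sgn ∧ (∀ x, sgn x = -1 ∨ sgn x = 1) ∧
          (∀ (f : C₀(X, ℝ)) (y : Y), I f y = sgn (ϕ.symm y) * f (ϕ.symm y)) ∧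
          ∀ f : C₀(X, ℝ), ‖T f - I f‖ ≤ 76 * ((M : ℝ) - 1) * ‖f‖ + (Δ M L : ℝ) := by
  refine ⟨fun _ L ↦ 30 * L, fun _ ↦ mul_zero _, ?_⟩
  intro X Y _ _ _ _ _ _ M L T hM hM' hT h0
  have hC := hT.isCoarseIsometry hM hM' h0
  obtain ⟨ϕ, σ, hσc, hσ, hϕ⟩ := hC.exists_homeomorph
  have hσ' : ∀ x, |σ x| = 1 := fun x ↦ by rcases hσ x with h | h <;> simp [h]
  refine ⟨ϕ, σ, weightedCompIsometry ϕ σ hσc hσ', hσc, fun x ↦ (hσ x).symm, fun _ _ ↦ rfl,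
    fun f ↦ ?_⟩
  have hM1 : 0 ≤ (M : ℝ) - 1 := sub_nonneg.2 hC.one_le
  refine norm_le_of_forall_abs_le (by positivity) fun y ↦ ?_
  have h := hC.abs_sub_le_of_tracks (hσ (ϕ.symm y)) (hϕ (ϕ.symm y)) f
  rw [ϕ.apply_symm_apply] at h
  refine h.trans ?_
  push_cast
  gcongr
  norm_num
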